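/- Let $0<r<1$ and let $\overline{\mathbb A}_r=\{z\in\mathbb C: r\le |z|\le 1\}$. Let $q(z_1,z_2)=z_1z_2-\frac{r}{1+r^2}$, let $Z(q)\subset\mathbb C^2$ be its zero set, and let $\overline{\mathbb B}_2=\{(z_1,z_2)\in\mathbb C^2:|z_1|^2+|z_2|^2\le 1\}$. A compact set $X\subset\mathbb C^n$ is called a spectral set for a commuting $n$-tuple $\underline T$ of bounded operators on a complex Hilbert space if the Taylor joint spectrum $\sigma_T(\underline T)$ (for $n=1$, the usual spectrum) is contained in $X$ and $\|p(\underline T)g(\underline T)^{-1}\|\le \sup_{\xi\in X}|p(\xi)/g(\xi)|$ for all polynomials $p,g\in\mathbb C[z_1,\dots,z_n]$ such that $g$ has no zeros in $X$. An operator is called an $\mathbb A_r$-contraction if $\overline{\mathbb A}_r$ is a spectral set for it. Theorem. Let $T$ be an invertible bounded operator on a complex Hilbert space $\mathcal H$. Then $T$ is an $\mathbb A_r$-contraction if and only if $Z(q)\cap\overline{\mathbb B}_2$ is a spectral set for the commuting pair $$\kappa(T)=\left(\frac{T}{\sqrt{1+r^2}},\ \frac{rT^{-1}}{\sqrt{1+r^2}}\right).$$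 -/

import Mathlib

noncomputable section

namespace AnnulusVariety

/-- The closed annulus of inner radius `r` and outer radius `1` about the origin in `ℂ`. -/
def closedAnnulus (r : ℝ) : Set ℂ := {z | r ≤ ‖z‖ ∧ ‖z‖ ≤ 1}

/-- The closed Euclidean unit ball of `ℂ²`. -/
def closedBiball : Set (Fin 2 → ℂ) := {z | ‖z 0‖ ^ 2 + ‖z 1‖ ^ 2 ≤ 1}

/-- The polynomial `q(z₁, z₂) = z₁ z₂ - r / (1 + r²)`. -/
def qPoly (r : ℝ) : MvPolynomial (Fin 2) ℂ :=
  MvPolynomial.X 0 * MvPolynomial.X 1 - MvPolynomial.C ((r : ℂ) / (1 + (r : ℂ) ^ 2))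

/-- The zero set in `ℂ²` of a polynomial in two variables. -/
def zeroSet (p : MvPolynomial (Fin 2) ℂ) : Set (Fin 2 → ℂ) :=
  {z | MvPolynomial.eval z p = 0}

/-- The principal variety `Z(q) ∩ B̄₂`. -/
def principalVariety (r : ℝ) : Set (Fin 2 → ℂ) := zeroSet (qPoly r) ∩ closedBiball

section Operators

variable {H : Type*} [NormedAddCommGroup H] [InnerProductSpace ℂ H]

/-- The first differential `x ↦ (A x, B x)` of the Koszul complex
`0 → H → H × H → H → 0` of the pair `(A, B)`. -/
def koszulZero (A B : H →L[ℂ] H) : H →L[ℂ] H × H := A.prod B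

/-- The second differential `(y, z) ↦ A z - B y` of the Koszul complex
`0 → H → H × H → H → 0` of the pair `(A, B)`. -/
def koszulOne (A B : H →L[ℂ] H) : H × H →L[ℂ] H :=
  A.comp (ContinuousLinearMap.snd ℂ H H) - B.comp (ContinuousLinearMap.fst ℂ H H)

/-- Exactness, at all three places, of the Koszul complex `0 → H → H × H → H → 0` of the
pair `(A, B)`. -/
def KoszulExact (A B : H →L[ℂ] H) : Prop :=
  Function.Injective (koszulZero A B) ∧
    Function.Exact (koszulZero A B) (koszulOne A B) ∧
    Function.Surjective (koszulOne A B)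

/-- The Taylor joint spectrum of a (commuting) pair `T = (T₁, T₂)`: the points `z` of `ℂ²` for
which the Koszul complex of `(T₁ - z₁, T₂ - z₂)` is not exact. -/
def taylorSpectrum (T : Fin 2 → (H →L[ℂ] H)) : Set (Fin 2 → ℂ) :=
  {z | ¬ KoszulExact (T 0 - z 0 • (1 : H →L[ℂ] H)) (T 1 - z 1 • (1 : H →L[ℂ] H))}

/-- The value `p(T₁, T₂) = ∑ aₘₙ T₁ᵐ T₂ⁿ` of the polynomial `p = ∑ aₘₙ z₁ᵐ z₂ⁿ` at a
(commuting) pair of operators. -/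
def polyEval (T : Fin 2 → (H →L[ℂ] H)) (p : MvPolynomial (Fin 2) ℂ) : H →L[ℂ] H :=
  ∑ m ∈ p.support, p.coeff m • (T 0 ^ m 0 * T 1 ^ m 1)

/-- `X ⊆ ℂ` is a spectral set for the operator `T`: `X` is compact, contains the spectrum of `T`,
and `‖f(T)‖ ≤ sup_X |f|` for every rational function `f = p / g` with `g` zero-free on `X`, where
`f(T) = p(T) g(T)⁻¹`. The operator `g(T)` is invertible because the spectrum lies in `X`. -/
structure IsSpectralSet (X : Set ℂ) (T : H →L[ℂ] H) : Prop where
  isCompact : IsCompact X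
  spectrum_subset : spectrum ℂ T ⊆ X
  vonNeumann : ∀ p g : Polynomial ℂ, (∀ z ∈ X, g.eval z ≠ 0) →
    ‖Polynomial.aeval T p * Ring.inverse (Polynomial.aeval T g)‖ ≤
      sSup ((fun z : ℂ => ‖p.eval z / g.eval z‖) '' X)

/-- `X ⊆ ℂ²` is a spectral set for the pair `T = (T₁, T₂)`: `T₁` and `T₂` commute, `X` is compact
and contains the Taylor joint spectrum of `T`, and `‖f(T)‖ ≤ sup_X |f|` for every rational
function `f = p / g` with `g` zero-free on `X`, where `f(T) = p(T) g(T)⁻¹`. The operator `g(T)`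
is invertible because the joint spectrum lies in `X`. -/
structure IsJointSpectralSet (X : Set (Fin 2 → ℂ)) (T : Fin 2 → (H →L[ℂ] H)) : Prop where
  commute : Commute (T 0) (T 1)
  isCompact : IsCompact X
  taylorSpectrum_subset : taylorSpectrum T ⊆ X
  vonNeumann : ∀ p g : MvPolynomial (Fin 2) ℂ, (∀ z ∈ X, MvPolynomial.eval z g ≠ 0) →
    ‖polyEval T p * Ring.inverse (polyEval T g)‖ ≤
      sSup ((fun z : Fin 2 → ℂ => ‖MvPolynomial.eval z p / MvPolynomial.eval z g‖) '' X)

/-- An `𝔸_r`-contraction: an operator having the closed annulus as a spectral set. -/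
def IsAnnulusContraction (r : ℝ) (T : H →L[ℂ] H) : Prop := IsSpectralSet (closedAnnulus r) T

/-- The pair `κ(T) = (T / √(1 + r²), r T⁻¹ / √(1 + r²))` of an invertible operator `T`. -/
def kappa (r : ℝ) (T : (H →L[ℂ] H)ˣ) : Fin 2 → (H →L[ℂ] H) :=
  ![((1 / Real.sqrt (1 + r ^ 2) : ℝ) : ℂ) • (T : H →L[ℂ] H),
    ((r / Real.sqrt (1 + r ^ 2) : ℝ) : ℂ) • ((T⁻¹ : (H →L[ℂ] H)ˣ) : H →L[ℂ] H)]

end Operators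

end AnnulusVariety

end

/-!
The map `φ(w) = (w, r / w) / √(1 + r²)` carries the closed annulus bijectively onto the principal
variety, because on `Z(q)` the ball condition reads `(‖w‖² - r²)(‖w‖² - 1) ≤ 0`. The pair `κ(T)` is
`φ(T)`, and both conditions of the theorem are transported along `φ`.

* *Functional calculus.* A polynomial `p` in two variables restricted to `φ` is a Laurent polynomial
  `P(w) / w ^ N`, and the same identity holds with an invertible operator in place of `w`
  (`laurentSum_mul_pow`, stated for units of an arbitrary algebra). Using one `N` for
  numerator and denominator, `p(κ(T)) g(κ(T))⁻¹ = P(T) G(T)⁻¹` (`polyEval_mul_inverse`) and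
  `p(φ(w)) / g(φ(w)) = P(w) / G(w)`. Conversely every polynomial in `w` is
  a polynomial in the first coordinate of `φ(w)` (`polyEval_pullback`).
* *Spectrum.* The Koszul complex of a commuting pair `(A, B)` is exact as soon as `C A + D B = 1` for
  operators commuting with `A` and `B` (`koszulExact_of_bezout`). Off `Z(q)` such a relation comes from
  `κ(T)₁ κ(T)₂ = r / (1 + r²)`, and on `Z(q)` outside the ball from the invertibility of
  `T - w`. In the other direction, at `φ(w)` the second
  operator is a multiple of the first, so exactness makes `T - w` bijective, hence invertible by the
  open mapping theorem (`embed_mem_taylorSpectrum`).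
-/

noncomputable section

namespace AnnulusVariety

/-! ### The parametrization of the variety by the annulus -/

/-- The constant `1 / √(1 + r²)`, as a complex number. -/
def scale (r : ℝ) : ℂ := ((1 / Real.sqrt (1 + r ^ 2) : ℝ) : ℂ)

/-- The parametrization `w ↦ (w, r / w) / √(1 + r²)` of `Z(q)` by `ℂ \ {0}`. -/
def embed (r : ℝ) (w : ℂ) : Fin 2 → ℂ := ![scale r * w, scale r * r * w⁻¹]

lemma embed_zero (r : ℝ) (w : ℂ) : embed r w 0 = scale r * w := rfl

lemma embed_one (r : ℝ) (w : ℂ) : embed r w 1 = scale r * r * w⁻¹ := rfl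

lemma scale_ne_zero (r : ℝ) : scale r ≠ 0 := by
  have : 0 < Real.sqrt (1 + r ^ 2) := by positivity
  exact Complex.ofReal_ne_zero.mpr (by positivity)

lemma norm_scale_sq (r : ℝ) : ‖scale r‖ ^ 2 = (1 + r ^ 2)⁻¹ := by
  rw [scale, Complex.norm_real, Real.norm_eq_abs, sq_abs, div_pow, Real.sq_sqrt (by positivity)]
  simp

lemma scale_sq_mul (r : ℝ) : scale r * scale r * r = (r : ℂ) / (1 + (r : ℂ) ^ 2) := by
  have h : (1 / Real.sqrt (1 + r ^ 2)) * (1 / Real.sqrt (1 + r ^ 2)) = (1 + r ^ 2)⁻¹ := by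
    rw [← sq, div_pow, Real.sq_sqrt (by positivity)]
    simp
  rw [scale, ← Complex.ofReal_mul, h]
  push_cast
  rw [div_eq_mul_inv, mul_comm]

lemma mem_zeroSet_qPoly {r : ℝ} {z : Fin 2 → ℂ} :
    z ∈ zeroSet (qPoly r) ↔ z 0 * z 1 = scale r * scale r * r := by
  simp [zeroSet, qPoly, scale_sq_mul, sub_eq_zero]

lemma embed_mem_zeroSet (r : ℝ) {w : ℂ} (hw : w ≠ 0) : embed r w ∈ zeroSet (qPoly r) := by
  rw [mem_zeroSet_qPoly]
  rw [embed_zero, embed_one]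
  field_simp

lemma embed_mem_closedBiball_iff {r : ℝ} (hr0 : 0 < r) (hr1 : r < 1) {w : ℂ} (hw : w ≠ 0) :
    embed r w ∈ closedBiball ↔ w ∈ closedAnnulus r := by
  have hw' : 0 < ‖w‖ := norm_pos_iff.mpr hw
  have hr : (0 : ℝ) < 1 + r ^ 2 := by positivity
  have key : ‖embed r w 0‖ ^ 2 + ‖embed r w 1‖ ^ 2 - 1
      = (‖w‖ ^ 2 - r ^ 2) * (‖w‖ ^ 2 - 1) / ((1 + r ^ 2) * ‖w‖ ^ 2) := by
    simp only [embed_zero, embed_one, norm_mul, mul_pow, norm_scale_sq,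
      norm_inv, Complex.norm_real, Real.norm_eq_abs, sq_abs]
    field_simp
    ring
  have h : embed r w ∈ closedBiball ↔ (‖w‖ ^ 2 - r ^ 2) * (‖w‖ ^ 2 - 1) ≤ 0 := by
    rw [closedBiball, Set.mem_ofPred_eq, ← sub_nonpos, key, div_le_iff₀ (by positivity), zero_mul]
  rw [h]
  constructor
  · intro h
    constructor
    · by_contra! hlt
      have h1 : ‖w‖ ^ 2 < r ^ 2 := by gcongr
      have h2 : r ^ 2 < 1 := by nlinarith
      nlinarith [mul_pos (sub_pos.mpr h1) (sub_pos.mpr (h1.trans h2))]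
    · by_contra! hlt
      have h1 : 1 < ‖w‖ ^ 2 := by nlinarith
      have h2 : r ^ 2 < 1 := by nlinarith
      nlinarith [mul_pos (sub_pos.mpr h1) (sub_pos.mpr (h2.trans h1))]
  · rintro ⟨h1, h2⟩
    exact mul_nonpos_of_nonneg_of_nonpos (by nlinarith) (by nlinarith)

lemma ne_zero_of_mem_closedAnnulus {r : ℝ} (hr0 : 0 < r) {w : ℂ} (hw : w ∈ closedAnnulus r) :
    w ≠ 0 := norm_pos_iff.mp (hr0.trans_le hw.1)

lemma embed_mem_principalVariety_iff {r : ℝ} (hr0 : 0 < r) (hr1 : r < 1) {w : ℂ} (hw : w ≠ 0) :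
    embed r w ∈ principalVariety r ↔ w ∈ closedAnnulus r :=
  (and_iff_right (embed_mem_zeroSet r hw)).trans (embed_mem_closedBiball_iff hr0 hr1 hw)

lemma exists_embed_eq {r : ℝ} (hr0 : 0 < r) {z : Fin 2 → ℂ} (hz : z ∈ zeroSet (qPoly r)) :
    ∃ w ≠ 0, embed r w = z := by
  rw [mem_zeroSet_qPoly] at hz
  have hs := scale_ne_zero r
  have hr : (r : ℂ) ≠ 0 := Complex.ofReal_ne_zero.mpr hr0.ne'
  have hz0 : z 0 ≠ 0 := by
    rintro h0
    rw [h0, zero_mul] at hz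
    exact mul_ne_zero (mul_ne_zero hs hs) hr hz.symm
  refine ⟨z 0 / scale r, div_ne_zero hz0 hs, ?_⟩
  ext i
  fin_cases i
  · simp [embed, mul_div_cancel₀ _ hs]
  · change scale r * r * (z 0 / scale r)⁻¹ = z 1
    field_simp
    linear_combination -hz

lemma principalVariety_eq_image {r : ℝ} (hr0 : 0 < r) (hr1 : r < 1) :
    principalVariety r = embed r '' closedAnnulus r := by
  ext z
  constructor
  · intro hz
    obtain ⟨w, hw, rfl⟩ := exists_embed_eq hr0 hz.1
    exact ⟨w, (embed_mem_principalVariety_iff hr0 hr1 hw).mp hz, rfl⟩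
  · rintro ⟨w, hw, rfl⟩
    exact (embed_mem_principalVariety_iff hr0 hr1 (ne_zero_of_mem_closedAnnulus hr0 hw)).mpr hw

lemma isCompact_closedAnnulus (r : ℝ) : IsCompact (closedAnnulus r) := by
  refine (isCompact_closedBall (0 : ℂ) 1).of_isClosed_subset ?_ fun z hz => by simpa using hz.2
  exact (isClosed_le continuous_const continuous_norm).inter
    (isClosed_le continuous_norm continuous_const)

lemma isCompact_principalVariety {r : ℝ} (hr0 : 0 < r) (hr1 : r < 1) :
    IsCompact (principalVariety r) := by
  rw [principalVariety_eq_image hr0 hr1]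
  refine (isCompact_closedAnnulus r).image_of_continuousOn (continuousOn_pi.mpr fun i => ?_)
  fin_cases i
  · exact (continuous_const.mul continuous_id).continuousOn
  · exact continuousOn_const.mul
      (continuousOn_id.inv₀ fun w hw => ne_zero_of_mem_closedAnnulus hr0 hw)

/-- The supremum over the variety is a supremum over the annulus, as soon as the two functions
correspond under the parametrization. -/
lemma image_principalVariety_eq {r : ℝ} (hr0 : 0 < r) (hr1 : r < 1) {F : (Fin 2 → ℂ) → ℝ}
    {f : ℂ → ℝ} (h : ∀ w ≠ 0, F (embed r w) = f w) :
    F '' principalVariety r = f '' closedAnnulus r := by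
  rw [principalVariety_eq_image hr0 hr1, Set.image_image]
  exact Set.image_congr fun w hw => h w (ne_zero_of_mem_closedAnnulus hr0 hw)

/-! ### Clearing denominators in Laurent polynomials -/

/-- The polynomial `w ^ N p(φ(w))`, where `φ` is the parametrization `embed r`. It is correct only
when `N` is at least the degree of `p` in the second variable, since the exponent is a truncated
difference. -/
def clearDenom (r : ℝ) (N : ℕ) (p : MvPolynomial (Fin 2) ℂ) : Polynomial ℂ :=
  ∑ m ∈ p.support, Polynomial.C (p.coeff m * scale r ^ m 0 * (scale r * r) ^ m 1) *
    Polynomial.X ^ (m 0 + (N - m 1))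

/-- Evaluation of `w ^ N p(φ(w))` at a unit `u` of an algebra; it serves both for numbers and for
operators. -/
lemma laurentSum_mul_pow {A : Type*} [Ring A] [Algebra ℂ A] (r : ℝ) (u : Aˣ) {N : ℕ}
    {p : MvPolynomial (Fin 2) ℂ} (hN : p.degreeOf 1 ≤ N) :
    (∑ m ∈ p.support, p.coeff m •
      ((scale r • (u : A)) ^ m 0 * ((scale r * r) • ((u⁻¹ : Aˣ) : A)) ^ m 1)) * (u : A) ^ N =
      Polynomial.aeval (u : A) (clearDenom r N p) := by
  rw [clearDenom, map_sum, Finset.sum_mul]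
  refine Finset.sum_congr rfl fun m hm => ?_
  have hm1 : m 1 ≤ N := (MvPolynomial.monomial_le_degreeOf 1 hm).trans hN
  have hu : ((u⁻¹ : Aˣ) : A) ^ m 1 * (u : A) ^ N = (u : A) ^ (N - m 1) := by
    rw [← Units.val_pow_eq_pow_val, ← Units.val_pow_eq_pow_val, ← Units.val_pow_eq_pow_val,
      ← Units.val_mul, inv_pow, pow_sub u hm1, (((Commute.refl u).pow_pow _ _).inv_left).eq]
  simp only [smul_pow, map_mul, Polynomial.aeval_C, map_pow, Polynomial.aeval_X, smul_mul_assoc,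
    mul_smul_comm, smul_smul, mul_assoc, hu, ← pow_add]
  simp only [← map_mul, ← map_pow, ← Algebra.smul_def, smul_smul]
  congr 1
  ring

lemma eval_embed_mul_pow (r : ℝ) {w : ℂ} (hw : w ≠ 0) {N : ℕ} {p : MvPolynomial (Fin 2) ℂ}
    (hN : p.degreeOf 1 ≤ N) :
    MvPolynomial.eval (embed r w) p * w ^ N = (clearDenom r N p).eval w := by
  have h := laurentSum_mul_pow r (Units.mk0 w hw) hN
  simpa [MvPolynomial.eval_eq', embed, Polynomial.coe_aeval_eq_eval] using h

section Operators

variable {H : Type*} [NormedAddCommGroup H] [InnerProductSpace ℂ H]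

lemma kappa_zero (r : ℝ) (T : (H →L[ℂ] H)ˣ) : kappa r T 0 = scale r • (T : H →L[ℂ] H) := rfl

lemma kappa_one (r : ℝ) (T : (H →L[ℂ] H)ˣ) :
    kappa r T 1 = (scale r * r) • ((T⁻¹ : (H →L[ℂ] H)ˣ) : H →L[ℂ] H) := by
  have : scale r * r = ((r / Real.sqrt (1 + r ^ 2) : ℝ) : ℂ) := by
    rw [scale, ← Complex.ofReal_mul, one_div, inv_mul_eq_div]
  rw [this]
  rfl

lemma polyEval_kappa_mul_pow (r : ℝ) (T : (H →L[ℂ] H)ˣ) {N : ℕ} {p : MvPolynomial (Fin 2) ℂ}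
    (hN : p.degreeOf 1 ≤ N) :
    polyEval (kappa r T) p * (T : H →L[ℂ] H) ^ N =
      Polynomial.aeval (T : H →L[ℂ] H) (clearDenom r N p) := by
  rw [← laurentSum_mul_pow r T hN, polyEval, kappa_zero, kappa_one]

lemma polyEval_kappa_eq (r : ℝ) (T : (H →L[ℂ] H)ˣ) {N : ℕ} {p : MvPolynomial (Fin 2) ℂ}
    (hN : p.degreeOf 1 ≤ N) :
    polyEval (kappa r T) p = Polynomial.aeval (T : H →L[ℂ] H) (clearDenom r N p) *
      (((T ^ N)⁻¹ : (H →L[ℂ] H)ˣ) : H →L[ℂ] H) := by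
  rw [← polyEval_kappa_mul_pow r T hN, ← Units.val_pow_eq_pow_val, Units.mul_inv_cancel_right]

/-- The powers of `T` introduced by clearing denominators cancel in a quotient. -/
lemma polyEval_mul_inverse (r : ℝ) (T : (H →L[ℂ] H)ˣ) {N : ℕ} {p g : MvPolynomial (Fin 2) ℂ}
    (hp : p.degreeOf 1 ≤ N) (hg : g.degreeOf 1 ≤ N) :
    polyEval (kappa r T) p * Ring.inverse (polyEval (kappa r T) g) =
      Polynomial.aeval (T : H →L[ℂ] H) (clearDenom r N p) *
        Ring.inverse (Polynomial.aeval (T : H →L[ℂ] H) (clearDenom r N g)) := by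
  have hc : Commute (Polynomial.aeval (T : H →L[ℂ] H) (clearDenom r N g))
      (((T ^ N)⁻¹ : (H →L[ℂ] H)ˣ) : H →L[ℂ] H) := by
    refine Commute.units_inv_right ?_
    rw [Units.val_pow_eq_pow_val, ← Polynomial.aeval_X_pow (R := ℂ)]
    exact (Commute.all _ _).map _
  rw [polyEval_kappa_eq r T hp, polyEval_kappa_eq r T hg, Ring.mul_inverse_rev' hc,
    Ring.inverse_unit, inv_inv, mul_assoc, Units.inv_mul_cancel_left]

/-- The polynomial `p(z₁ √(1 + r²))` in two variables, whose pullback along `embed r` is `p`. -/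
def pullback (r : ℝ) (p : Polynomial ℂ) : MvPolynomial (Fin 2) ℂ :=
  Polynomial.aeval (MvPolynomial.C (scale r)⁻¹ * MvPolynomial.X 0) p

lemma eval_pullback (r : ℝ) (p : Polynomial ℂ) (w : ℂ) :
    MvPolynomial.eval (embed r w) (pullback r p) = p.eval w := by
  rw [pullback, ← MvPolynomial.coe_aeval_eq_eval, RingHom.coe_coe, ← Polynomial.aeval_algHom_apply]
  simp [embed_zero, inv_mul_cancel_left₀ (scale_ne_zero r)]

lemma polyEval_pullback (r : ℝ) (T : (H →L[ℂ] H)ˣ) (p : Polynomial ℂ) :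
    polyEval (kappa r T) (pullback r p) = Polynomial.aeval (T : H →L[ℂ] H) p := by
  set N := (pullback r p).degreeOf 1 with hN
  have h : clearDenom r N (pullback r p) = p * Polynomial.X ^ N := by
    refine Polynomial.eq_of_infinite_eval_eq _ _ ?_
    refine (Set.finite_singleton (0 : ℂ)).infinite_compl.mono fun w hw => ?_
    rw [Set.mem_ofPred_eq, ← eval_embed_mul_pow r hw hN.ge, eval_pullback]
    simp
  rw [polyEval_kappa_eq r T hN.ge, h, map_mul, map_pow, Polynomial.aeval_X,
    ← Units.val_pow_eq_pow_val, Units.mul_inv_cancel_right]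

/-! ### Exactness of Koszul complexes -/

/-- A Bézout relation `C A + D B = 1` with commuting coefficients splits the Koszul complex. -/
lemma koszulExact_of_bezout {A B C D : H →L[ℂ] H} (hAB : Commute A B) (hAC : Commute A C)
    (hAD : Commute A D) (hBC : Commute B C) (hBD : Commute B D) (h : C * A + D * B = 1) :
    KoszulExact A B := by
  have ap {S S' : H →L[ℂ] H} (hS : Commute S S') (x : H) : S (S' x) = S' (S x) :=
    DFunLike.congr_fun hS.eq x
  have h1 (x : H) : C (A x) + D (B x) = x := DFunLike.congr_fun h x
  refine ⟨fun x y hxy => ?_, fun yz => ⟨fun hyz => ?_, ?_⟩, fun x => ⟨(-D x, C x), ?_⟩⟩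
  · have hA : A x = A y := congrArg Prod.fst hxy
    have hB : B x = B y := congrArg Prod.snd hxy
    rw [← h1 x, ← h1 y, hA, hB]
  · obtain ⟨y, z⟩ := yz
    have hyz' : A z = B y := sub_eq_zero.mp hyz
    refine ⟨C y + D z, Prod.ext ?_ ?_⟩
    · change A (C y + D z) = y
      rw [map_add, ap hAC, ap hAD, hyz', h1]
    · change B (C y + D z) = z
      rw [map_add, ap hBC, ap hBD, ← hyz', h1]
  · rintro ⟨x, rfl⟩
    exact sub_eq_zero.mpr (ap hAB x)
  · change A (C x) - B (-D x) = x
    rw [map_neg, sub_neg_eq_add, ap hAC, ap hBD, h1]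

lemma commute_kappa (r : ℝ) (T : (H →L[ℂ] H)ˣ) : Commute (kappa r T 0) (kappa r T 1) := by
  rw [kappa_zero, kappa_one]
  exact ((Commute.refl (T : H →L[ℂ] H)).units_inv_right.smul_left _).smul_right _

lemma kappa_mul (r : ℝ) (T : (H →L[ℂ] H)ˣ) :
    kappa r T 0 * kappa r T 1 = (scale r * scale r * r) • (1 : H →L[ℂ] H) := by
  rw [kappa_zero, kappa_one, smul_mul_smul_comm, Units.mul_inv, mul_assoc]

lemma commute_sub_smul_one {A B : H →L[ℂ] H} (h : Commute A B) (a b : ℂ) :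
    Commute (A - a • 1) (B - b • 1) :=
  ((h.sub_right ((Commute.one_right A).smul_right b))).sub_left
    ((Commute.one_left _).smul_left a)

/-- The Taylor spectrum of `κ(T)` consists of points of `Z(q)`, and their parameters lie in the
spectrum of `T`. -/
lemma taylorSpectrum_kappa_subset {r : ℝ} (hr0 : 0 < r) (T : (H →L[ℂ] H)ˣ) :
    taylorSpectrum (kappa r T) ⊆ embed r '' (spectrum ℂ (T : H →L[ℂ] H) \ {0}) := by
  intro z hz
  by_contra hz'
  refine hz ?_
  have hc := commute_sub_smul_one (commute_kappa r T) (z 0) (z 1)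
  have h0 := commute_sub_smul_one (Commute.refl (kappa r T 0)) (z 0) 0
  have h1 := (commute_sub_smul_one (commute_kappa r T) 0 (z 1)).symm
  simp only [zero_smul, sub_zero] at h0 h1
  by_cases hq : z ∈ zeroSet (qPoly r)
  · obtain ⟨w, hw, rfl⟩ := exists_embed_eq hr0 hq
    have hwT : w ∉ spectrum ℂ (T : H →L[ℂ] H) := fun h => hz' ⟨w, ⟨h, hw⟩, rfl⟩
    rw [spectrum.notMem_iff] at hwT
    have hA : IsUnit (kappa r T 0 - embed r w 0 • (1 : H →L[ℂ] H)) := by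
      have : kappa r T 0 - embed r w 0 • (1 : H →L[ℂ] H) =
          Units.mk0 (-scale r) (neg_ne_zero.mpr (scale_ne_zero r)) •
            (algebraMap ℂ (H →L[ℂ] H) w - T) := by
        rw [kappa_zero, Algebra.algebraMap_eq_smul_one, Units.smul_def, Units.val_mk0, smul_sub,
          smul_smul, neg_smul, neg_mul, neg_smul, sub_neg_eq_add, neg_add_eq_sub]
        rfl
      rw [this]
      exact hwT.smul _
    obtain ⟨U, hU⟩ := hA
    rw [← hU] at hc ⊢
    exact koszulExact_of_bezout (C := (U⁻¹ : (H →L[ℂ] H)ˣ)) (D := 0) hc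
      (Commute.refl _).units_inv_right (Commute.zero_right _) hc.symm.units_inv_right
      (Commute.zero_right _) (by simp)
  · rw [mem_zeroSet_qPoly] at hq
    -- `z₂ (κ₁ - z₁) + κ₁ (κ₂ - z₂) = κ₁ κ₂ - z₁ z₂` is a nonzero multiple of the identity.
    set d := scale r * scale r * r - z 0 * z 1 with hd
    have hd0 : d ≠ 0 := sub_ne_zero.mpr (Ne.symm hq)
    refine koszulExact_of_bezout (C := (d⁻¹ * z 1) • 1) (D := d⁻¹ • kappa r T 0) hc
      ((Commute.one_right _).smul_right _) (h0.smul_right _)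
      ((Commute.one_right _).smul_right _) (h1.smul_right _) ?_
    calc _ = d⁻¹ • (kappa r T 0 * kappa r T 1 - (z 0 * z 1) • 1) := by
          simp only [smul_mul_assoc, one_mul, mul_sub, mul_smul_comm, mul_one]
          module
      _ = 1 := by rw [kappa_mul, ← sub_smul, smul_smul, inv_mul_cancel₀ hd0, one_smul]

/-- At `φ(w)` the second operator of the Koszul complex is a left multiple of the first, so that
exactness forces `T - w` to be bijective. -/
lemma embed_mem_taylorSpectrum [CompleteSpace H] (r : ℝ) (T : (H →L[ℂ] H)ˣ) {w : ℂ}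
    (hw : w ∈ spectrum ℂ (T : H →L[ℂ] H)) : embed r w ∈ taylorSpectrum (kappa r T) := by
  intro hex
  have hw0 : w ≠ 0 := spectrum.ne_zero_of_mem_of_unit hw
  set A : H →L[ℂ] H := kappa r T 0 - embed r w 0 • 1 with hA
  set B : H →L[ℂ] H := kappa r T 1 - embed r w 1 • 1 with hB
  have hA' : A = scale r • ((T : H →L[ℂ] H) - w • 1) := by
    rw [hA, kappa_zero, smul_sub, smul_smul]
    rfl
  -- The multiplier comes from `r T⁻¹ - r / w = -(r / w) T⁻¹ (T - w)`.
  obtain ⟨K, hBK, hBK'⟩ : ∃ K, B = A * K ∧ B = K * A := by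
    refine ⟨(-(r * w⁻¹)) • ((T⁻¹ : (H →L[ℂ] H)ˣ) : H →L[ℂ] H), ?_, ?_⟩
    · rw [hB, hA', kappa_one, smul_mul_smul_comm, sub_mul, Units.mul_inv, smul_mul_assoc, one_mul,
        smul_sub, smul_smul]
      have : scale r * -(r * w⁻¹) * w = -(scale r * r) := by field_simp
      rw [this]
      rw [embed_one]
      module
    · rw [hB, hA', kappa_one, smul_mul_smul_comm, mul_sub, Units.inv_mul, mul_smul_comm, mul_one,
        smul_sub, smul_smul]
      have : -(r * w⁻¹) * scale r * w = -(scale r * r) := by field_simp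
      rw [this]
      rw [embed_one]
      module
  have hinj : Function.Injective A := fun x y hxy =>
    hex.1 (Prod.ext hxy (by
      change B x = B y
      rw [hBK']
      exact congrArg K hxy))
  have hsurj : Function.Surjective A := fun x => by
    obtain ⟨⟨y, z⟩, hyz⟩ := hex.2.2 x
    refine ⟨z - K y, ?_⟩
    have hyz' : A z - B y = x := hyz
    rw [map_sub, ← hyz', hBK]
    rfl
  have hunit : IsUnit A := ContinuousLinearMap.isUnit_iff_bijective.mpr ⟨hinj, hsurj⟩
  refine spectrum.mem_iff.mp hw ?_
  have : algebraMap ℂ (H →L[ℂ] H) w - T =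
      Units.mk0 (-(scale r)⁻¹) (neg_ne_zero.mpr (inv_ne_zero (scale_ne_zero r))) • A := by
    rw [hA', Units.smul_def, Units.val_mk0, smul_smul, neg_mul, inv_mul_cancel₀ (scale_ne_zero r),
      Algebra.algebraMap_eq_smul_one, neg_one_smul, neg_sub]
  rw [this]
  exact hunit.smul _

end Operators

end AnnulusVariety

end

/-! ### The equivalence -/

open AnnulusVariety in
theorem theorem3p7 {H : Type*} [NormedAddCommGroup H] [InnerProductSpace ℂ H] [CompleteSpace H]
    (r : ℝ) (hr0 : 0 < r) (hr1 : r < 1) (T : (H →L[ℂ] H)ˣ) :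
    AnnulusVariety.IsAnnulusContraction r (T : H →L[ℂ] H) ↔
      AnnulusVariety.IsJointSpectralSet (AnnulusVariety.principalVariety r)
        (AnnulusVariety.kappa r T) := by
  constructor
  · intro h
    refine ⟨commute_kappa r T, isCompact_principalVariety hr0 hr1, ?_, fun p g hg => ?_⟩
    · refine (taylorSpectrum_kappa_subset hr0 T).trans ?_
      rw [principalVariety_eq_image hr0 hr1]
      exact Set.image_mono (Set.sdiff_subset.trans h.spectrum_subset)
    · set N := max (p.degreeOf 1) (g.degreeOf 1)
      have hp' : p.degreeOf 1 ≤ N := le_max_left _ _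
      have hg' : g.degreeOf 1 ≤ N := le_max_right _ _
      rw [polyEval_mul_inverse r T hp' hg', image_principalVariety_eq hr0 hr1
        (f := fun w => ‖(clearDenom r N p).eval w / (clearDenom r N g).eval w‖)]
      · refine h.vonNeumann _ _ fun w hw => ?_
        have hw0 := ne_zero_of_mem_closedAnnulus hr0 hw
        rw [← eval_embed_mul_pow r hw0 hg']
        exact mul_ne_zero (hg _ ((embed_mem_principalVariety_iff hr0 hr1 hw0).mpr hw))
          (pow_ne_zero _ hw0)
      · intro w hw0
        rw [← eval_embed_mul_pow r hw0 hp', ← eval_embed_mul_pow r hw0 hg',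
          mul_div_mul_right _ _ (pow_ne_zero _ hw0)]
  · intro h
    refine ⟨isCompact_closedAnnulus r, fun w hw => ?_, fun p g hg => ?_⟩
    · exact (embed_mem_principalVariety_iff hr0 hr1 (spectrum.ne_zero_of_mem_of_unit hw)).mp
        (h.taylorSpectrum_subset (embed_mem_taylorSpectrum r T hw))
    · have key := h.vonNeumann (pullback r p) (pullback r g) fun z hz => by
        rw [principalVariety_eq_image hr0 hr1] at hz
        obtain ⟨w, hw, rfl⟩ := hz
        rw [eval_pullback]
        exact hg w hw
      rwa [polyEval_pullback, polyEval_pullback, image_principalVariety_eq hr0 hr1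
        (f := fun w => ‖p.eval w / g.eval w‖) fun w _ => by
          simp only [eval_pullback]] at key
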